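/- **Setting.** Let $\mathcal A$ be a separable unital $C^*$-algebra, and let $\sigma$ be an automorphism of $\mathcal A$ with $\sigma^2=\mathrm{id}$ (the grading). Let $\alpha$ be an action of $\mathbb Z^d$ on $\mathcal A$ by automorphisms commuting with $\sigma$, and let $(\Omega,\mu)$ be a standard probability space with a measure preserving action $T_x$ ($x\in\mathbb Z^d$). For each $\omega\in\Omega$ let $(\tau^\omega_t)_{t\in\mathbb R}$ be a one-parameter group of automorphisms of $\mathcal A$. Put $\mathfrak A:=\mathcal A\otimes L^\infty(\Omega,\mu)$, the closed $*$-subalgebra of $L^\infty(\Omega,\mu;\mathcal A)$ generated by the functions $\omega\mapsto f(\omega)A$. Assume that $(t,\omega)\mapsto\tau^\omega_t(A)$ is jointly measurable for each $A\in\mathcal A$, that $\omega\mapsto\tau^\omega_t(A)$ belongs to $\mathfrak A$ for all $A\in\mathcal A$, $t\in\mathbb R$, that $\tau_t^{T_x\omega}\alpha_x=\alpha_x\tau^\omega_t$, and that for all $t$ and $A$ one has $\tau^\omega_t(\sigma(A))=\sigma(\tau^\omega_t(A))$ for almost all $\omega$. On $\mathfrak A$ consider the evolution $\mathfrak t_t(A)(\omega)=\tau^\omega_t(A(\omega))$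 and the grading $\mathfrak s(A)(\omega)=\sigma(A(\omega))$. A state is *even* if it is $\mathfrak s$-invariant. Let $\beta\neq0$ and let $\varphi$ be an even $\mathfrak t$-KMS state on $\mathfrak A$ at inverse temperature $\beta$ whose restriction to $L^\infty(\Omega,\mu)$ is normal, with GNS triple $(\mathcal H_\varphi,\pi_\varphi,\Phi)$. Let $\mathfrak Z_\varphi$ be the centre of $\pi_\varphi(\mathfrak A)''$. Let $\varphi_T$ be an even $\mathfrak t$-KMS state on $\mathfrak A$ at inverse temperature $\beta$, normal with respect to $\varphi$ and described by a positive operator $T$ affiliated with $\mathfrak Z_\varphi$, that is, $\varphi_T(A)=\langle\pi_\varphi(A)T^{1/2}\Phi,T^{1/2}\Phi\rangle$ for $A\in\mathfrak A$. Suppose that $T$ is bounded. **Claim.** 1. $T$ is even: there is a unitary $V$ on $\mathcal H_\varphi$ with $V\Phi=\Phi$ and $V\pi_\varphi(A)V^*=\pi_\varphi(\mathfrak s(A))$ for all $A\in\mathfrak A$ (necessarily unique), and $VTV=T$. 2. Let $\varphi(A)=\int_\Omega\varphi_\omega(A(\omega))\,d\mu(\omega)$ be the decomposition of $\varphi$ through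 a weak-$*$ measurable field of positive forms $\varphi_\omega$ on $\mathcal A$, with GNS triples $(\mathcal H_\omega,\pi_\omega,\Psi_\omega)$. Let $T(\omega)$ be a measurable field of positive self-adjoint (possibly unbounded) operators on $\mathcal H_\omega$, almost surely affiliated with the centre of $\pi_\omega(\mathcal A)''$ and with $\Psi_\omega$ in the domain of $T(\omega)^{1/2}$, such that $$\varphi_T(A)=\int_\Omega\big\langle\pi_\omega(A(\omega))T(\omega)^{1/2}\Psi_\omega,\,T(\omega)^{1/2}\Psi_\omega\big\rangle\,d\mu(\omega),\qquad A\in\mathfrak A .$$ Then, for almost all $\omega$, $T(\omega)$ is bounded and even: there is a unitary $V_\omega$ on $\mathcal H_\omega$ with $V_\omega\Psi_\omega=\Psi_\omega$, $V_\omega\pi_\omega(A)V_\omega^*=\pi_\omega(\sigma(A))$ for all $A\in\mathcal A$, and $V_\omega T(\omega)V_\omega=T(\omega)$. -/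

import Mathlib

open MeasureTheory
open scoped ENNReal

/-! ### The C*-algebra `L^∞(Ω, μ; A)` of essentially bounded functions with values in `A` -/

noncomputable section

namespace LInfinity

variable {Ω A : Type*} [MeasurableSpace Ω] {μ : Measure Ω} [CStarAlgebra A]

instance instMul : Mul (Lp A ∞ μ) where
  mul f g := ((Lp.memLp g).mul (Lp.memLp f) : MemLp (⇑f * ⇑g) ∞ μ).toLp (⇑f * ⇑g)

instance instOne : One (Lp A ∞ μ) where
  one := (memLp_top_const (1 : A)).toLp (fun _ => (1 : A))

theorem coeFn_mul (f g : Lp A ∞ μ) : ∀ᵐ ω ∂μ, (f * g : Lp A ∞ μ) ω = f ω * g ω :=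
  MemLp.coeFn_toLp ((Lp.memLp g).mul (Lp.memLp f) : MemLp (⇑f * ⇑g) ∞ μ)

theorem coeFn_one : ∀ᵐ ω ∂μ, (1 : Lp A ∞ μ) ω = 1 :=
  MemLp.coeFn_toLp (memLp_top_const (1 : A))

theorem coeFn_add (f g : Lp A ∞ μ) : ∀ᵐ ω ∂μ, (f + g : Lp A ∞ μ) ω = f ω + g ω :=
  Lp.coeFn_add f g

theorem coeFn_smul (c : ℂ) (f : Lp A ∞ μ) : ∀ᵐ ω ∂μ, (c • f : Lp A ∞ μ) ω = c • f ω :=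
  Lp.coeFn_smul c f

theorem coeFn_star (f : Lp A ∞ μ) : ∀ᵐ ω ∂μ, (star f : Lp A ∞ μ) ω = star (f ω) :=
  Lp.coeFn_star f

theorem norm_coeFn_le (f : Lp A ∞ μ) : ∀ᵐ ω ∂μ, ‖f ω‖ ≤ ‖f‖ := by
  filter_upwards [enorm_ae_le_eLpNormEssSup f μ] with ω h
  have h' : ‖f ω‖ₑ ≤ eLpNorm f ∞ μ := by simpa using h
  rw [Lp.norm_def]
  simpa using ENNReal.toReal_mono (Lp.eLpNorm_ne_top f) h'

theorem norm_le_of_ae (f : Lp A ∞ μ) {C : ℝ} (hC : 0 ≤ C) (h : ∀ᵐ ω ∂μ, ‖f ω‖ ≤ C) :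
    ‖f‖ ≤ C := by
  rw [Lp.norm_def, eLpNorm_exponent_top]
  exact ENNReal.toReal_le_of_le_ofReal hC (eLpNormEssSup_le_of_ae_bound h)

instance instNormedRing : NormedRing (Lp A ∞ μ) where
  __ := (inferInstance : NormedAddCommGroup (Lp A ∞ μ))
  mul := (· * ·)
  one := 1
  left_distrib f g h := by
    apply Lp.ext
    filter_upwards [coeFn_mul f (g + h), coeFn_add g h, coeFn_add (f * g) (f * h),
      coeFn_mul f g, coeFn_mul f h] with ω h1 h2 h3 h4 h5
    rw [h1, h2, h3, h4, h5, mul_add]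
  right_distrib f g h := by
    apply Lp.ext
    filter_upwards [coeFn_mul (f + g) h, coeFn_add f g, coeFn_add (f * h) (g * h),
      coeFn_mul f h, coeFn_mul g h] with ω h1 h2 h3 h4 h5
    rw [h1, h2, h3, h4, h5, add_mul]
  zero_mul f := by
    apply Lp.ext
    filter_upwards [coeFn_mul 0 f, Lp.coeFn_zero A ∞ μ] with ω h1 h2
    rw [h1, h2]; simp
  mul_zero f := by
    apply Lp.ext
    filter_upwards [coeFn_mul f 0, Lp.coeFn_zero A ∞ μ] with ω h1 h2
    rw [h1, h2]; simp
  mul_assoc f g h := by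
    apply Lp.ext
    filter_upwards [coeFn_mul (f * g) h, coeFn_mul f (g * h), coeFn_mul f g,
      coeFn_mul g h] with ω h1 h2 h3 h4
    rw [h1, h2, h3, h4, mul_assoc]
  one_mul f := by
    apply Lp.ext
    filter_upwards [coeFn_mul 1 f, coeFn_one (A := A) (μ := μ)] with ω h1 h2
    rw [h1, h2, one_mul]
  mul_one f := by
    apply Lp.ext
    filter_upwards [coeFn_mul f 1, coeFn_one (A := A) (μ := μ)] with ω h1 h2
    rw [h1, h2, mul_one]
  norm_mul_le f g := by
    apply norm_le_of_ae _ (by positivity)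
    filter_upwards [coeFn_mul f g, norm_coeFn_le f, norm_coeFn_le g] with ω h1 h2 h3
    rw [h1]
    exact (norm_mul_le _ _).trans (by gcongr)

instance instCStarAlgebra : CStarAlgebra (Lp A ∞ μ) where
  star_involutive := star_involutive
  star_mul f g := by
    apply Lp.ext
    filter_upwards [coeFn_star (f * g), coeFn_mul f g, coeFn_mul (star g) (star f),
      coeFn_star f, coeFn_star g] with ω h1 h2 h3 h4 h5
    rw [h1, h2, h3, h4, h5, star_mul]
  star_add f g := by
    apply Lp.ext
    filter_upwards [coeFn_star (f + g), coeFn_add f g, coeFn_add (star f) (star g),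
      coeFn_star f, coeFn_star g] with ω h1 h2 h3 h4 h5
    rw [h1, h2, h3, h4, h5, star_add]
  norm_mul_self_le f := by
    have h : ‖f‖ ≤ √‖star f * f‖ := by
      apply norm_le_of_ae _ (Real.sqrt_nonneg _)
      filter_upwards [coeFn_mul (star f) f, coeFn_star f, norm_coeFn_le (star f * f)]
        with ω h1 h2 h3
      apply Real.le_sqrt_of_sq_le
      rw [h1, h2, CStarRing.norm_star_mul_self] at h3
      rwa [sq]
    calc ‖f‖ * ‖f‖ ≤ √‖star f * f‖ * √‖star f * f‖ := by gcongr
      _ = ‖star f * f‖ := Real.mul_self_sqrt (norm_nonneg _)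
  __ := Algebra.ofModule
    (fun c f g => by
      apply Lp.ext
      filter_upwards [coeFn_mul (c • f) g, coeFn_smul c f, coeFn_smul c (f * g),
        coeFn_mul f g] with ω h1 h2 h3 h4
      rw [h1, h2, h3, h4, smul_mul_assoc])
    (fun c f g => by
      apply Lp.ext
      filter_upwards [coeFn_mul f (c • g), coeFn_smul c g, coeFn_smul c (f * g),
        coeFn_mul f g] with ω h1 h2 h3 h4
      rw [h1, h2, h3, h4, mul_smul_comm])
  norm_smul_le c f := norm_smul_le c f
  star_smul c f := by
    apply Lp.ext
    filter_upwards [coeFn_star (c • f), coeFn_smul c f, coeFn_smul (star c) (star f),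
      coeFn_star f] with ω h1 h2 h3 h4
    rw [h1, h2, h3, h4, star_smul]

/-- The elementary tensor `a ⊗ f`, that is, the function `ω ↦ f(ω) a`. -/
def tensor (a : A) (f : Lp ℂ ∞ μ) : Lp A ∞ μ :=
  (ContinuousLinearMap.toSpanSingleton ℂ a).compLp f

theorem coeFn_const_tensor [IsFiniteMeasure μ] (a : A) :
    ∀ᵐ ω ∂μ, tensor a (Lp.const ∞ μ (1 : ℂ)) ω = a := by
  filter_upwards [ContinuousLinearMap.coeFn_compLp (ContinuousLinearMap.toSpanSingleton ℂ a)
    (Lp.const ∞ μ (1 : ℂ)), Lp.coeFn_const ∞ μ (1 : ℂ)] with ω h1 h2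
  rw [tensor, h1, h2]
  simp

/-- A measurable field `F` of unital *-endomorphisms of `A` acts fibrewise on `L^∞(Ω, μ; A)`:
the image of `f` is the class of `ω ↦ F ω (f ω)`. -/
theorem memLp_fibre [TopologicalSpace.SeparableSpace A] (F : Ω → A →⋆ₐ[ℂ] A)
    (hF : ∀ a, StronglyMeasurable fun ω => F ω a) (f : Lp A ∞ μ) :
    MemLp (fun ω => F ω (f ω)) ∞ μ := by
  have hle : ∀ ω a, ‖F ω a‖ ≤ ‖a‖ := fun ω a => NonUnitalStarAlgHom.norm_apply_le (F ω) a
  refine memLp_top_of_bound ?_ ‖f‖ ?_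
  · borelize A
    have : SecondCountableTopology A := UniformSpace.secondCountable_of_separable A
    have hu : StronglyMeasurable (Function.uncurry fun (a : A) (ω : Ω) => F ω a) :=
      stronglyMeasurable_uncurry_of_continuous_of_stronglyMeasurable
        (fun ω => AddMonoidHomClass.continuous_of_bound (F ω) 1
          (fun a => by simpa using hle ω a)) hF
    exact (hu.comp_measurable
      ((Lp.stronglyMeasurable f).measurable.prodMk measurable_id)).aestronglyMeasurable
  · filter_upwards [norm_coeFn_le f] with ω h
    exact (hle ω _).trans h

/-- The fibrewise action of a measurable field of unital *-endomorphisms. -/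
def fibreHom [TopologicalSpace.SeparableSpace A] (F : Ω → A →⋆ₐ[ℂ] A)
    (hF : ∀ a, StronglyMeasurable fun ω => F ω a) : Lp A ∞ μ →⋆ₐ[ℂ] Lp A ∞ μ where
  toFun f := (memLp_fibre F hF f).toLp _
  map_one' := by
    apply Lp.ext
    filter_upwards [MemLp.coeFn_toLp (memLp_fibre F hF (1 : Lp A ∞ μ)),
      coeFn_one (A := A) (μ := μ)] with ω h1 h2
    rw [h1, h2, map_one]
  map_mul' f g := by
    apply Lp.ext
    filter_upwards [MemLp.coeFn_toLp (memLp_fibre F hF (f * g)),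
      MemLp.coeFn_toLp (memLp_fibre F hF f), MemLp.coeFn_toLp (memLp_fibre F hF g), coeFn_mul f g,
      coeFn_mul ((memLp_fibre F hF f).toLp _) ((memLp_fibre F hF g).toLp _)] with ω h1 h2 h3 h4 h5
    rw [h1, h5, h2, h3, h4, map_mul]
  map_zero' := by
    apply Lp.ext
    filter_upwards [MemLp.coeFn_toLp (memLp_fibre F hF (0 : Lp A ∞ μ)),
      Lp.coeFn_zero A ∞ μ] with ω h1 h2
    rw [h1, h2]; simp
  map_add' f g := by
    apply Lp.ext
    filter_upwards [MemLp.coeFn_toLp (memLp_fibre F hF (f + g)),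
      MemLp.coeFn_toLp (memLp_fibre F hF f), MemLp.coeFn_toLp (memLp_fibre F hF g), coeFn_add f g,
      coeFn_add ((memLp_fibre F hF f).toLp _) ((memLp_fibre F hF g).toLp _)] with ω h1 h2 h3 h4 h5
    rw [h1, h5, h2, h3, h4, map_add]
  commutes' c := by
    rw [Algebra.algebraMap_eq_smul_one]
    apply Lp.ext
    filter_upwards [MemLp.coeFn_toLp (memLp_fibre F hF (c • (1 : Lp A ∞ μ))),
      coeFn_smul c (1 : Lp A ∞ μ), coeFn_one (A := A) (μ := μ)] with ω h1 h2 h3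
    rw [h1, h2, h3, map_smul, map_one]
  map_star' f := by
    apply Lp.ext
    filter_upwards [MemLp.coeFn_toLp (memLp_fibre F hF (star f)),
      MemLp.coeFn_toLp (memLp_fibre F hF f), coeFn_star f,
      coeFn_star ((memLp_fibre F hF f).toLp _)] with ω h1 h2 h3 h4
    rw [h1, h4, h2, h3, map_star]

theorem coeFn_fibreHom [TopologicalSpace.SeparableSpace A] (F : Ω → A →⋆ₐ[ℂ] A)
    (hF : ∀ a, StronglyMeasurable fun ω => F ω a) (f : Lp A ∞ μ) :
    ∀ᵐ ω ∂μ, fibreHom (μ := μ) F hF f ω = F ω (f ω) :=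
  MemLp.coeFn_toLp (memLp_fibre F hF f)

end LInfinity

open LInfinity

/-- The C*-algebra `A ⊗ L^∞(Ω, μ)`: the closed *-subalgebra of `L^∞(Ω, μ; A)` generated by the
elementary tensors. -/
def disorderedAlgebra (A : Type*) [CStarAlgebra A] {Ω : Type*} [MeasurableSpace Ω]
    (μ : Measure Ω) : StarSubalgebra ℂ (Lp A ∞ μ) :=
  (StarAlgebra.adjoin ℂ {F : Lp A ∞ μ | ∃ a f, F = tensor a f}).topologicalClosure

theorem tensor_mem_disorderedAlgebra {A : Type*} [CStarAlgebra A] {Ω : Type*} [MeasurableSpace Ω]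
    {μ : Measure Ω} (a : A) (f : Lp ℂ ∞ μ) : tensor a f ∈ disorderedAlgebra A μ :=
  StarSubalgebra.le_topologicalClosure _ (StarAlgebra.subset_adjoin ℂ _ ⟨a, f, rfl⟩)

instance {A : Type*} [CStarAlgebra A] {Ω : Type*} [MeasurableSpace Ω] (μ : Measure Ω) :
    IsClosed (disorderedAlgebra A μ : Set (Lp A ∞ μ)) :=
  StarSubalgebra.isClosed_topologicalClosure _

theorem fibreHom_mem {A : Type*} [CStarAlgebra A] [TopologicalSpace.SeparableSpace A]
    {Ω : Type*} [MeasurableSpace Ω] {μ : Measure Ω} (F : Ω → A →⋆ₐ[ℂ] A)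
    (hF : ∀ a, StronglyMeasurable fun ω => F ω a)
    (hloc : ∀ a, ∃ G ∈ disorderedAlgebra A μ, ∀ᵐ ω ∂μ, G ω = F ω a)
    (f : Lp A ∞ μ) (hf : f ∈ disorderedAlgebra A μ) :
    fibreHom F hF f ∈ disorderedAlgebra A μ := by
  have key : disorderedAlgebra A μ ≤ (disorderedAlgebra A μ).comap (fibreHom F hF) := by
    refine StarSubalgebra.topologicalClosure_minimal (StarAlgebra.adjoin_le ?_) ?_
    · rintro _ ⟨a, f, rfl⟩
      obtain ⟨G, hG, hGa⟩ := hloc a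
      have h : fibreHom F hF (tensor a f) = tensor 1 f * G := by
        apply Lp.ext
        filter_upwards [coeFn_fibreHom F hF (tensor a f), coeFn_mul (tensor 1 f) G, hGa,
          ContinuousLinearMap.coeFn_compLp (ContinuousLinearMap.toSpanSingleton ℂ a) f,
          ContinuousLinearMap.coeFn_compLp (ContinuousLinearMap.toSpanSingleton ℂ (1 : A)) f]
          with ω h1 h2 h3 h4 h5
        rw [h1, h2, h3, tensor, tensor, h4, h5]
        simp
      change fibreHom F hF (tensor a f) ∈ disorderedAlgebra A μ
      rw [h]
      exact mul_mem (tensor_mem_disorderedAlgebra 1 f) hG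
    · exact (inferInstance : IsClosed (disorderedAlgebra A μ : Set (Lp A ∞ μ))).preimage
        (AddMonoidHomClass.continuous_of_bound (fibreHom (μ := μ) F hF) 1
          (fun a => by simpa using NonUnitalStarAlgHom.norm_apply_le (fibreHom (μ := μ) F hF) a))
  exact key hf

/-- The action on `A ⊗ L^∞(Ω, μ)` of a measurable field of *-endomorphisms of `A` that acts
locally. -/
def fibreAction {A : Type*} [CStarAlgebra A] [TopologicalSpace.SeparableSpace A]
    {Ω : Type*} [MeasurableSpace Ω] {μ : Measure Ω} (F : Ω → A →⋆ₐ[ℂ] A)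
    (hF : ∀ a, StronglyMeasurable fun ω => F ω a)
    (hloc : ∀ a, ∃ G ∈ disorderedAlgebra A μ, ∀ᵐ ω ∂μ, G ω = F ω a) :
    disorderedAlgebra A μ →⋆ₐ[ℂ] disorderedAlgebra A μ :=
  ((fibreHom F hF).comp (disorderedAlgebra A μ).subtype).codRestrict (disorderedAlgebra A μ)
    (fun f => fibreHom_mem F hF hloc f f.2)

/-! ### The model -/

/-- A disordered `ℤ₂`-graded system on the lattice `ℤ^d`: a C*-algebra `A` with a grading `σ` and
spatial translations `α`, a sample space `(Ω, μ)` with a measure preserving action `shift` of the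
spatial translations, and a random one-parameter group `τ` of automorphisms of `A`, jointly
measurable, acting locally, covariant under the translations and even. -/
structure DisorderedSystem (d : ℕ) (A : Type*) [CStarAlgebra A] {Ω : Type*} [MeasurableSpace Ω]
    (μ : Measure Ω) where
  σ : A ≃⋆ₐ[ℂ] A
  σ_σ : ∀ a, σ (σ a) = a
  α : (Fin d → ℤ) → A ≃⋆ₐ[ℂ] A
  α_zero : ∀ a, α 0 a = a
  α_add : ∀ x y a, α (x + y) a = α x (α y a)
  σ_α : ∀ x a, σ (α x a) = α x (σ a)
  shift : (Fin d → ℤ) → Ω → Ω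
  shift_zero : ∀ ω, shift 0 ω = ω
  shift_add : ∀ x y ω, shift (x + y) ω = shift x (shift y ω)
  shift_measurePreserving : ∀ x, MeasurePreserving (shift x) μ μ
  τ : ℝ → Ω → A ≃⋆ₐ[ℂ] A
  τ_zero : ∀ ω a, τ 0 ω a = a
  τ_add : ∀ s t ω a, τ (s + t) ω a = τ s ω (τ t ω a)
  τ_measurable : ∀ a, StronglyMeasurable fun p : ℝ × Ω => τ p.1 p.2 a
  τ_isLocal : ∀ t a, ∃ G ∈ disorderedAlgebra A μ, ∀ᵐ ω ∂μ, G ω = τ t ω a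
  τ_covariant : ∀ x ω t a, τ t (shift x ω) (α x a) = α x (τ t ω a)
  τ_even : ∀ t a, ∀ᵐ ω ∂μ, τ t ω (σ a) = σ (τ t ω a)

namespace DisorderedSystem

variable {d : ℕ} {A : Type*} [CStarAlgebra A] [TopologicalSpace.SeparableSpace A]
  {Ω : Type*} [MeasurableSpace Ω] {μ : Measure Ω} [IsProbabilityMeasure μ]

/-- The time evolution of `A ⊗ L^∞(Ω, μ)`: `f` evolves to `ω ↦ τ t ω (f ω)`. -/
def evolution (D : DisorderedSystem d A μ) (t : ℝ) :
    disorderedAlgebra A μ →⋆ₐ[ℂ] disorderedAlgebra A μ :=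
  fibreAction (fun ω => (D.τ t ω : A →⋆ₐ[ℂ] A))
    (fun a => (D.τ_measurable a).comp_measurable measurable_prodMk_left) (D.τ_isLocal t)

/-- The grading `σ ⊗ id` of `A ⊗ L^∞(Ω, μ)`: `f` is sent to `ω ↦ σ (f ω)`. -/
def grading (D : DisorderedSystem d A μ) :
    disorderedAlgebra A μ →⋆ₐ[ℂ] disorderedAlgebra A μ :=
  fibreAction (fun _ => (D.σ : A →⋆ₐ[ℂ] A)) (fun _ => stronglyMeasurable_const)
    (fun a => ⟨_, tensor_mem_disorderedAlgebra (D.σ a) (Lp.const ∞ μ (1 : ℂ)),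
      coeFn_const_tensor (D.σ a)⟩)

end DisorderedSystem

/-! ### States, the KMS condition and GNS representations -/

section Algebra

variable {B : Type*} [CStarAlgebra B]

/-- Positive linear forms. -/
def IsPositiveForm (φ : B →ₗ[ℂ] ℂ) : Prop :=
  ∀ a, 0 ≤ (φ (star a * a)).re ∧ (φ (star a * a)).im = 0

/-- States: normalized positive linear forms. -/
def IsState (φ : B →ₗ[ℂ] ℂ) : Prop :=
  IsPositiveForm φ ∧ φ 1 = 1

/-- The entire function that extends the Fourier transform of `g`. -/
def fourierLaplace (g : ℝ → ℂ) (z : ℂ) : ℂ :=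
  ∫ s : ℝ, Complex.exp (-Complex.I * s * z) * g s

/-- The KMS boundary condition at inverse temperature `β` with respect to the evolution `τ`. -/
def IsKMS (τ : ℝ → B →⋆ₐ[ℂ] B) (β : ℝ) (φ : B →ₗ[ℂ] ℂ) : Prop :=
  (∀ a b, Continuous fun t => φ (a * τ t b)) ∧
  ∀ a b, ∀ g : ℝ → ℂ, ContDiff ℝ (⊤ : ℕ∞) g → HasCompactSupport g →
    ∫ t : ℝ, φ (a * τ t b) * fourierLaplace g t =
      ∫ t : ℝ, φ (τ t b * a) * fourierLaplace g (t + Complex.I * β)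

variable {H : Type*} [NormedAddCommGroup H] [InnerProductSpace ℂ H] [CompleteSpace H]

/-- `(H, π, Ψ)` is the GNS triple of the positive form `φ`: a representation with a cyclic vector
that induces `φ`. -/
def IsGNS (φ : B →ₗ[ℂ] ℂ) (π : B →⋆ₐ[ℂ] (H →L[ℂ] H)) (Ψ : H) : Prop :=
  (∀ a, φ a = inner ℂ Ψ (π a Ψ)) ∧ Dense (Set.range fun a => π a Ψ)

/-- The von Neumann algebra generated by a representation, as the bicommutant of its range. -/
def generatedVN (π : B →⋆ₐ[ℂ] (H →L[ℂ] H)) : Set (H →L[ℂ] H) :=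
  Set.centralizer (Set.centralizer (Set.range π))

/-- The centre of the von Neumann algebra generated by a representation. -/
def centreVN (π : B →⋆ₐ[ℂ] (H →L[ℂ] H)) : Set (H →L[ℂ] H) :=
  generatedVN π ∩ Set.centralizer (generatedVN π)

/-- `V` is the unitary that implements the automorphism `θ` covariantly in the cyclic
representation `(H, π, Ψ)`. -/
def Implements (π : B →⋆ₐ[ℂ] (H →L[ℂ] H)) (Ψ : H) (θ : B → B) (V : H →L[ℂ] H) : Prop :=
  V ∈ unitary (H →L[ℂ] H) ∧ V Ψ = Ψ ∧ ∀ a, V * π a * star V = π (θ a)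

/-- A bounded operator `T` is even: the unitary `V` implementing the grading exists and
`V T V = T`. -/
def IsEvenOperator (π : B →⋆ₐ[ℂ] (H →L[ℂ] H)) (Ψ : H) (θ : B → B) (T : H →L[ℂ] H) : Prop :=
  ∃ V : H →L[ℂ] H, Implements π Ψ θ V ∧ V * T * V = T

/-- The vector form `a ↦ ⟨π(a) T^{1/2} Ψ, T^{1/2} Ψ⟩` of a bounded positive `T` equals `ψ`. -/
def Describes (π : B →⋆ₐ[ℂ] (H →L[ℂ] H)) (Ψ : H) (T : H →L[ℂ] H) (ψ : B →ₗ[ℂ] ℂ) : Prop :=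
  ∀ a, ψ a = inner ℂ (CFC.sqrt T Ψ) (π a (CFC.sqrt T Ψ))

end Algebra

/-! ### Possibly unbounded operators -/

section Unbounded

variable {H : Type*} [NormedAddCommGroup H] [InnerProductSpace ℂ H] [CompleteSpace H]

/-- Positive self-adjoint, possibly unbounded, operators. Self-adjointness includes that the
domain is dense. -/
def IsPositiveSelfAdjoint (T : H →ₗ.[ℂ] H) : Prop :=
  IsSelfAdjoint T ∧ ∀ x : T.domain, 0 ≤ (inner ℂ (x : H) (T x)).re

/-- `T` is affiliated with the von Neumann algebra `M`: every unitary `U` of the commutant of `M`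
satisfies `U T = T U`, that is, maps the graph of `T` onto itself (the inclusion suffices, as
`U⁻¹` is such a unitary too). -/
def IsAffiliated (M : Set (H →L[ℂ] H)) (T : H →ₗ.[ℂ] H) : Prop :=
  ∀ U ∈ Set.centralizer M, U ∈ unitary (H →L[ℂ] H) →
    ∀ x y, (x, y) ∈ T.graph → (U x, U y) ∈ T.graph

/-- `S` is the positive square root of `T`: it is positive self-adjoint, and `S S = T` with the
natural domain of the composition. -/
def IsPositiveSqrt (S T : H →ₗ.[ℂ] H) : Prop :=
  IsPositiveSelfAdjoint S ∧
    ∀ x y, (x, y) ∈ T.graph ↔ ∃ z, (x, z) ∈ S.graph ∧ (z, y) ∈ S.graph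

end Unbounded

/-! ### States of the disordered system -/

section States

variable {A : Type*} [CStarAlgebra A] {Ω : Type*} [MeasurableSpace Ω] {μ : Measure Ω}

/-- The restriction of `φ` to `1 ⊗ L^∞(Ω, μ)` is normal. -/
def IsNormalOnCentre (φ : disorderedAlgebra A μ →ₗ[ℂ] ℂ) : Prop :=
  ∃ g : Ω → ℂ, Integrable g μ ∧
    ∀ f : Lp ℂ ∞ μ, φ ⟨tensor 1 f, tensor_mem_disorderedAlgebra 1 f⟩ = ∫ ω, f ω * g ω ∂μ

/-- The direct integral decomposition `φ(F) = ∫ φ_ω(F(ω)) dμ(ω)` through a field of positive forms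
on `A`. The integrability of `ω ↦ φ_ω(F(ω))` contains the weak-* measurability of the field. -/
def IsDisintegration (φ : disorderedAlgebra A μ →ₗ[ℂ] ℂ) (φfib : Ω → A →ₗ[ℂ] ℂ) : Prop :=
  (∀ ω, IsPositiveForm (φfib ω)) ∧
  ∀ F : disorderedAlgebra A μ, Integrable (fun ω => φfib ω ((F : Lp A ∞ μ) ω)) μ ∧
    φ F = ∫ ω, φfib ω ((F : Lp A ∞ μ) ω) ∂μ

/-- The field `T(ω)` of positive operators, each affiliated with the centre of the von Neumann
algebra generated by `π_ω`, with `Ψ_ω` in the domain of `T(ω)^{1/2}` almost surely, describes `ψ`: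
`ψ(F) = ∫ ⟨π_ω(F(ω)) T(ω)^{1/2} Ψ_ω, T(ω)^{1/2} Ψ_ω⟩ dμ(ω)`.
Here `η ω` is the vector `T(ω)^{1/2} Ψ_ω`. -/
def FibrewiseDescribes {K : Ω → Type*} [∀ ω, NormedAddCommGroup (K ω)]
    [∀ ω, InnerProductSpace ℂ (K ω)] [∀ ω, CompleteSpace (K ω)]
    (π : ∀ ω, A →⋆ₐ[ℂ] (K ω →L[ℂ] K ω)) (Ψ : ∀ ω, K ω) (T : ∀ ω, K ω →ₗ.[ℂ] K ω)
    (ψ : disorderedAlgebra A μ →ₗ[ℂ] ℂ) : Prop :=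
  ∃ η : ∀ ω, K ω,
    (∀ᵐ ω ∂μ, IsPositiveSelfAdjoint (T ω) ∧ IsAffiliated (centreVN (π ω)) (T ω) ∧
      ∃ S : K ω →ₗ.[ℂ] K ω, IsPositiveSqrt S (T ω) ∧ (Ψ ω, η ω) ∈ S.graph) ∧
    ∀ F : disorderedAlgebra A μ,
      Integrable (fun ω => inner ℂ (η ω) (π ω ((F : Lp A ∞ μ) ω) (η ω))) μ ∧
      ψ F = ∫ ω, inner ℂ (η ω) (π ω ((F : Lp A ∞ μ) ω) (η ω)) ∂μ

end States

end

/-!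
In a cyclic representation, an involution that leaves the vector form of `Ψ` invariant is
implemented by a self-adjoint unitary `V` fixing `Ψ`. If `S` is bounded, self-adjoint and in the
commutant, then the vector form of `S Ψ` determines `S² Ψ`, so invariance of this form means
`V S² Ψ = S² Ψ`, which by cyclicity is `V S² V = S²`. With `S = T^{1/2}` this gives the first claim.

For the second claim, boundedness of `T` dominates `φ_T` by a multiple of `φ`. Testing on `a ⊗ 1_s`
and using separability, both the domination and the invariance pass to almost every fibre. In such a
fibre `‖π_ω(a) T(ω)^{1/2} Ψ_ω‖ ≤ C ‖π_ω(a) Ψ_ω‖`, and `T(ω)^{1/2}` is affiliated with the commutant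
of `π_ω(A)`, so `T(ω)^{1/2}` is bounded and the first argument applies to it.

That the square root `S` of `T` commutes with every unitary that commutes with `T` is seen from
`(1 + S²)⁻¹` and `S (1 + S²)⁻¹`, the components of the orthogonal projection of `(h, 0)` onto the
graph of `S`: the former is determined by `T`, and the latter is the positive square root of
`(1 + S²)⁻¹ - (1 + S²)⁻²`.
-/

open scoped CStarAlgebra InnerProductSpace ComplexOrder

/-! ### Square roots of positive self-adjoint operators -/

section SelfAdjoint

variable {H : Type*} [NormedAddCommGroup H] [InnerProductSpace ℂ H]

/-- The graph of a partially defined operator as a subspace of the Hilbert space `H ⊕ H`, where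
orthogonal projections are available. -/
def hilbertGraph (S : H →ₗ.[ℂ] H) : Submodule ℂ (WithLp 2 (H × H)) :=
  S.graph.comap (WithLp.linearEquiv 2 ℂ (H × H)).toLinearMap

theorem isClosed_hilbertGraph {S : H →ₗ.[ℂ] H} (hS : S.IsClosed) :
    IsClosed (hilbertGraph S : Set (WithLp 2 (H × H))) :=
  IsClosed.preimage (WithLp.prod_continuous_ofLp 2 H H) hS

theorem mem_graph_toPMap_top (X : H →L[ℂ] H) {x y : H} :
    (x, y) ∈ ((X : H →ₗ[ℂ] H).toPMap ⊤).graph ↔ X x = y := by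
  simp [LinearPMap.mem_graph_iff]

theorem eq_toPMap_top_of_dense {S : H →ₗ.[ℂ] H} (hS : S.IsClosed) (X : H →L[ℂ] H) {D : Set H}
    (hD : Dense D) (h : ∀ x ∈ D, (x, X x) ∈ S.graph) : S = (X : H →ₗ[ℂ] H).toPMap ⊤ := by
  have hmem : ∀ x, (x, X x) ∈ S.graph :=
    hD.induction h (IsClosed.preimage (by fun_prop : Continuous fun x => (x, X x)) hS)
  apply LinearPMap.eq_of_eq_graph
  ext ⟨x, y⟩
  rw [mem_graph_toPMap_top]
  exact ⟨fun hxy => S.mem_graph_snd_inj (hmem x) hxy rfl, fun hxy => hxy ▸ hmem x⟩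

variable [CompleteSpace H]

theorem mem_graph_iff_of_isSelfAdjoint {S : H →ₗ.[ℂ] H} (hS : IsSelfAdjoint S) {x y : H} :
    (x, y) ∈ S.graph ↔ ∀ u v, (u, v) ∈ S.graph → ⟪v, x⟫_ℂ = ⟪u, y⟫_ℂ := by
  conv_lhs => rw [← LinearPMap.isSelfAdjoint_def.mp hS,
    LinearPMap.adjoint_graph_eq_graph_adjoint hS.dense_domain]
  simp [Submodule.mem_adjoint_iff, sub_eq_zero, -LinearPMap.mem_graph_iff]

theorem inner_eq_inner_of_mem_graph {S : H →ₗ.[ℂ] H} (hS : IsSelfAdjoint S) {x y u v : H}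
    (hxy : (x, y) ∈ S.graph) (huv : (u, v) ∈ S.graph) : ⟪v, x⟫_ℂ = ⟪u, y⟫_ℂ :=
  (mem_graph_iff_of_isSelfAdjoint hS).mp hxy u v huv

theorem mem_orthogonal_hilbertGraph_iff {S : H →ₗ.[ℂ] H} (hS : IsSelfAdjoint S) {x y : H} :
    WithLp.toLp 2 (y, -x) ∈ (hilbertGraph S)ᗮ ↔ (x, y) ∈ S.graph := by
  rw [mem_graph_iff_of_isSelfAdjoint hS, Submodule.mem_orthogonal]
  refine ⟨fun h u v huv => ?_, fun h w hw => ?_⟩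
  · have := h (WithLp.toLp 2 (u, v)) huv
    rw [WithLp.prod_inner_apply, inner_neg_right, add_neg_eq_zero] at this
    exact this.symm
  · rw [WithLp.prod_inner_apply, inner_neg_right, add_neg_eq_zero]
    exact (h w.fst w.snd hw).symm

/-- The map that projects `(h, 0)` orthogonally onto the closure of the graph of `S`. -/
noncomputable def graphProjection (S : H →ₗ.[ℂ] H) : H →L[ℂ] WithLp 2 (H × H) :=
  (hilbertGraph S).topologicalClosure.starProjection ∘L
    (WithLp.prodContinuousLinearEquiv 2 ℂ H H).symm ∘L ContinuousLinearMap.inl ℂ H H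

/-- The bounded operator `(1 + S²)⁻¹`, for a self-adjoint `S`. -/
noncomputable def invOneAddSq (S : H →ₗ.[ℂ] H) : H →L[ℂ] H :=
  WithLp.fstL 2 ℂ H H ∘L graphProjection S

/-- The bounded operator `S (1 + S²)⁻¹`, for a self-adjoint `S`. -/
noncomputable def mulInvOneAddSq (S : H →ₗ.[ℂ] H) : H →L[ℂ] H :=
  WithLp.sndL 2 ℂ H H ∘L graphProjection S

theorem invOneAddSq_mem_graph {S : H →ₗ.[ℂ] H} (hS : S.IsClosed) (h : H) :
    (invOneAddSq S h, mulInvOneAddSq S h) ∈ S.graph := by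
  have hmem : graphProjection S h ∈ (hilbertGraph S).topologicalClosure :=
    Submodule.starProjection_apply_mem _ _
  rwa [(isClosed_hilbertGraph hS).submodule_topologicalClosure_eq] at hmem

theorem mulInvOneAddSq_mem_graph {S : H →ₗ.[ℂ] H} (hS : IsSelfAdjoint S) (h : H) :
    (mulInvOneAddSq S h, h - invOneAddSq S h) ∈ S.graph := by
  rw [← mem_orthogonal_hilbertGraph_iff hS, ← Submodule.orthogonal_closure]
  have hmem : WithLp.toLp 2 (h, 0) - graphProjection S h ∈
      (hilbertGraph S).topologicalClosureᗮ :=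
    Submodule.sub_starProjection_mem_orthogonal _
  convert hmem using 1
  exact WithLp.ofLp_injective 2 (Prod.ext rfl (zero_sub _).symm)

theorem graphProjection_add {S : H →ₗ.[ℂ] H} (hS : IsSelfAdjoint S) {x y z : H}
    (hxy : (x, y) ∈ S.graph) (hyz : (y, z) ∈ S.graph) :
    graphProjection S (x + z) = WithLp.toLp 2 (x, y) := by
  refine Submodule.eq_starProjection_of_mem_orthogonal
    (Submodule.le_topologicalClosure _ hxy) ?_
  rw [Submodule.orthogonal_closure]
  convert (mem_orthogonal_hilbertGraph_iff hS).mpr hyz using 1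
  exact WithLp.ofLp_injective 2 (Prod.ext (add_sub_cancel_left x z) (zero_sub y))

theorem invOneAddSq_add {S : H →ₗ.[ℂ] H} (hS : IsSelfAdjoint S) {x y z : H}
    (hxy : (x, y) ∈ S.graph) (hyz : (y, z) ∈ S.graph) : invOneAddSq S (x + z) = x :=
  congrArg WithLp.fst (graphProjection_add hS hxy hyz)

theorem mulInvOneAddSq_add {S : H →ₗ.[ℂ] H} (hS : IsSelfAdjoint S) {x y z : H}
    (hxy : (x, y) ∈ S.graph) (hyz : (y, z) ∈ S.graph) : mulInvOneAddSq S (x + z) = y :=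
  congrArg WithLp.snd (graphProjection_add hS hxy hyz)

theorem mem_graph_iff_invOneAddSq {S : H →ₗ.[ℂ] H} (hS : IsSelfAdjoint S) {x y : H} :
    (x, y) ∈ S.graph ↔
      invOneAddSq S y = mulInvOneAddSq S x ∧ mulInvOneAddSq S y = x - invOneAddSq S x := by
  constructor
  · intro hxy
    have hmid := mulInvOneAddSq_mem_graph hS x
    have hdiff := S.graph.sub_mem hxy (invOneAddSq_mem_graph hS.isClosed x)
    have e : mulInvOneAddSq S x + (y - mulInvOneAddSq S x) = y := add_sub_cancel _ _
    exact ⟨e ▸ invOneAddSq_add hS hmid hdiff, e ▸ mulInvOneAddSq_add hS hmid hdiff⟩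
  · rintro ⟨hR, hB⟩
    have h := S.graph.add_mem (mulInvOneAddSq_mem_graph hS y) (invOneAddSq_mem_graph hS.isClosed x)
    rw [Prod.mk_add_mk, hR, hB, sub_add_cancel, sub_add_cancel] at h
    exact h

theorem mulInvOneAddSq_mul_self {S : H →ₗ.[ℂ] H} (hS : IsSelfAdjoint S) :
    mulInvOneAddSq S * mulInvOneAddSq S = invOneAddSq S - invOneAddSq S * invOneAddSq S := by
  ext h
  exact ((mem_graph_iff_invOneAddSq hS).mp (invOneAddSq_mem_graph hS.isClosed h)).2

theorem IsPositiveSelfAdjoint.inner_nonneg {S : H →ₗ.[ℂ] H} (hS : IsPositiveSelfAdjoint S)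
    {x y : H} (hxy : (x, y) ∈ S.graph) : 0 ≤ ⟪x, y⟫_ℂ := by
  have him : (⟪x, y⟫_ℂ).im = 0 := by
    rw [← Complex.conj_eq_iff_im, inner_conj_symm]
    exact inner_eq_inner_of_mem_graph hS.1 hxy hxy
  obtain ⟨u, rfl, rfl⟩ := (LinearPMap.mem_graph_iff S).mp hxy
  exact Complex.nonneg_iff.mpr ⟨hS.2 u, him.symm⟩

theorem mulInvOneAddSq_nonneg {S : H →ₗ.[ℂ] H} (hS : IsPositiveSelfAdjoint S) :
    0 ≤ mulInvOneAddSq S := by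
  rw [ContinuousLinearMap.nonneg_iff_isPositive, ContinuousLinearMap.isPositive_iff_complex]
  intro h
  have hR := invOneAddSq_mem_graph hS.1.isClosed h
  have hB := mulInvOneAddSq_mem_graph hS.1 h
  have hsum : ⟪mulInvOneAddSq S h, h⟫_ℂ = ⟪invOneAddSq S h, mulInvOneAddSq S h⟫_ℂ +
      ⟪mulInvOneAddSq S h, h - invOneAddSq S h⟫_ℂ := by
    rw [← inner_eq_inner_of_mem_graph hS.1 hR hR, ← inner_add_right, add_sub_cancel]
  have hnonneg : 0 ≤ ⟪mulInvOneAddSq S h, h⟫_ℂ :=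
    hsum ▸ add_nonneg (hS.inner_nonneg hR) (hS.inner_nonneg hB)
  obtain ⟨hre, him⟩ := Complex.nonneg_iff.mp hnonneg
  exact ⟨Complex.ext rfl him, hre⟩

theorem sqrt_invOneAddSq_sub {S : H →ₗ.[ℂ] H} (hS : IsPositiveSelfAdjoint S) :
    CFC.sqrt (invOneAddSq S - invOneAddSq S * invOneAddSq S) = mulInvOneAddSq S :=
  CFC.sqrt_unique (mulInvOneAddSq_mul_self hS.1) (mulInvOneAddSq_nonneg hS)

theorem mem_graph_of_commute_invOneAddSq {S : H →ₗ.[ℂ] H} (hS : IsPositiveSelfAdjoint S)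
    {X : H →L[ℂ] H} (hX : Commute (invOneAddSq S) X) {x y : H} (hxy : (x, y) ∈ S.graph) :
    (X x, X y) ∈ S.graph := by
  have hB : Commute (mulInvOneAddSq S) X := by
    rw [← sqrt_invOneAddSq_sub hS]
    exact (hX.sub_left (hX.mul_left hX)).cfcₙ_nnreal _
  have hR_apply : ∀ z, invOneAddSq S (X z) = X (invOneAddSq S z) := DFunLike.congr_fun hX
  have hB_apply : ∀ z, mulInvOneAddSq S (X z) = X (mulInvOneAddSq S z) := DFunLike.congr_fun hB
  obtain ⟨h₁, h₂⟩ := (mem_graph_iff_invOneAddSq hS.1).mp hxy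
  rw [mem_graph_iff_invOneAddSq hS.1, hR_apply, hR_apply, hB_apply, hB_apply, h₁, h₂, map_sub]
  exact ⟨rfl, rfl⟩

theorem IsPositiveSqrt.commute_invOneAddSq {S T : H →ₗ.[ℂ] H} (hS : IsPositiveSqrt S T)
    {X : H →L[ℂ] H} (hX : ∀ x y, (x, y) ∈ T.graph → (X x, X y) ∈ T.graph) :
    Commute (invOneAddSq S) X := by
  ext h
  have hT : (invOneAddSq S h, h - invOneAddSq S h) ∈ T.graph := (hS.2 _ _).mpr
    ⟨_, invOneAddSq_mem_graph hS.1.1.isClosed h, mulInvOneAddSq_mem_graph hS.1.1 h⟩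
  obtain ⟨z, hxz, hzy⟩ := (hS.2 _ _).mp (hX _ _ hT)
  have := invOneAddSq_add hS.1.1 hxz hzy
  rwa [← map_add, add_sub_cancel] at this

theorem IsAffiliated.mono {M N : Set (H →L[ℂ] H)} (hMN : M ⊆ N) {T : H →ₗ.[ℂ] H}
    (hT : IsAffiliated M T) : IsAffiliated N T :=
  fun U hU => hT U (Set.centralizer_subset hMN hU)

theorem IsAffiliated.of_isPositiveSqrt {M : Set (H →L[ℂ] H)} {S T : H →ₗ.[ℂ] H}
    (hT : IsAffiliated M T) (hS : IsPositiveSqrt S T) : IsAffiliated M S :=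
  fun U hUM hU _ _ =>
    mem_graph_of_commute_invOneAddSq hS.1 (hS.commute_invOneAddSq (hT U hUM hU))

theorem isSelfAdjoint_of_toPMap_top {X : H →L[ℂ] H}
    (hX : IsSelfAdjoint ((X : H →ₗ[ℂ] H).toPMap ⊤)) : IsSelfAdjoint X := by
  rw [ContinuousLinearMap.isSelfAdjoint_iff']
  ext x
  refine ext_inner_left ℂ fun y => ?_
  rw [ContinuousLinearMap.adjoint_inner_right]
  exact inner_eq_inner_of_mem_graph hX ((mem_graph_toPMap_top X).mpr rfl)
    ((mem_graph_toPMap_top X).mpr rfl)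

theorem IsPositiveSqrt.eq_mul_self {X : H →L[ℂ] H} {T : H →ₗ.[ℂ] H}
    (h : IsPositiveSqrt ((X : H →ₗ[ℂ] H).toPMap ⊤) T) :
    T = ((X * X : H →L[ℂ] H) : H →ₗ[ℂ] H).toPMap ⊤ := by
  apply LinearPMap.eq_of_eq_graph
  ext ⟨x, y⟩
  rw [h.2, mem_graph_toPMap_top]
  simp only [mem_graph_toPMap_top, exists_eq_left']
  rfl

end SelfAdjoint

/-! ### Even operators in cyclic representations -/

section Representation

variable {B : Type*} [CStarAlgebra B] {H : Type*} [NormedAddCommGroup H] [InnerProductSpace ℂ H]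
  [CompleteSpace H] {π : B →⋆ₐ[ℂ] (H →L[ℂ] H)}

/-- The orbit map `a ↦ π(a) ξ` of a vector in a representation. -/
noncomputable def orbitMap (π : B →⋆ₐ[ℂ] (H →L[ℂ] H)) (ξ : H) : B →ₗ[ℂ] H :=
  (ContinuousLinearMap.apply ℂ H ξ : (H →L[ℂ] H) →ₗ[ℂ] H) ∘ₗ (π : B →ₗ[ℂ] H →L[ℂ] H)

/-- The form `a ↦ ⟨π(a) ξ, ξ⟩` that a vector of a representation induces (the inner product of
Mathlib is linear in the second argument). -/
noncomputable def vectorForm (π : B →⋆ₐ[ℂ] (H →L[ℂ] H)) (ξ : H) : B →L[ℂ] ℂ where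
  toLinearMap := (innerSL ℂ ξ : H →ₗ[ℂ] ℂ) ∘ₗ orbitMap π ξ
  cont := (innerSL ℂ ξ).continuous.comp
    ((ContinuousLinearMap.apply ℂ H ξ).continuous.comp (map_continuous π))

theorem vectorForm_apply (ξ : H) (a : B) : vectorForm π ξ a = ⟪ξ, π a ξ⟫_ℂ := rfl

theorem inner_representation_left (a : B) (x y : H) : ⟪π a x, y⟫_ℂ = ⟪x, π (star a) y⟫_ℂ := by
  rw [map_star, ContinuousLinearMap.star_eq_adjoint, ContinuousLinearMap.adjoint_inner_right]

theorem representation_mul_apply (a b : B) (x : H) : π (a * b) x = π a (π b x) := by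
  rw [map_mul, mul_apply_eq_comp]

theorem re_vectorForm_star_mul_self (ξ : H) (a : B) :
    (vectorForm π ξ (star a * a)).re = ‖π a ξ‖ ^ 2 := by
  rw [vectorForm_apply, representation_mul_apply, ← inner_representation_left]
  exact inner_self_eq_norm_sq (𝕜 := ℂ) _

theorem eq_of_eq_on_orbit {Ψ : H} (hΨ : Dense (Set.range fun a => π a Ψ)) {X Y : H →L[ℂ] H}
    (h : ∀ a, X (π a Ψ) = Y (π a Ψ)) : X = Y :=
  DFunLike.coe_injective <|
    X.continuous.ext_on hΨ Y.continuous (Set.forall_mem_range.mpr h)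

theorem exists_extension_of_orbit {Ψ : H} (hΨ : Dense (Set.range fun a => π a Ψ)) (f : B →ₗ[ℂ] H)
    {C : ℝ} (hC : ∀ a, ‖f a‖ ≤ C * ‖π a Ψ‖) : ∃ X : H →L[ℂ] H, ∀ a, X (π a Ψ) = f a :=
  ⟨f.extendOfNorm (orbitMap π Ψ), LinearMap.extendOfNorm_eq hΨ ⟨C, hC⟩⟩

theorem exists_implements {Ψ : H} (hΨ : Dense (Set.range fun a => π a Ψ)) {θ : B →⋆ₐ[ℂ] B}
    (hθ : ∀ a, θ (θ a) = a) (hinv : ∀ a, vectorForm π Ψ (θ a) = vectorForm π Ψ a) :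
    ∃ V : H →L[ℂ] H, Implements π Ψ θ V ∧ IsSelfAdjoint V ∧ ∀ a, V (π a Ψ) = π (θ a) Ψ := by
  have hnorm : ∀ a, ‖π (θ a) Ψ‖ = ‖π a Ψ‖ := fun a => by
    rw [← sq_eq_sq₀ (norm_nonneg _) (norm_nonneg _), ← re_vectorForm_star_mul_self,
      ← re_vectorForm_star_mul_self, ← hinv (star a * a), map_mul θ, map_star θ]
  obtain ⟨V, hV⟩ := exists_extension_of_orbit hΨ (orbitMap π Ψ ∘ₗ (θ : B →ₗ[ℂ] B)) (C := 1)
    fun a => (hnorm a).trans_le (one_mul _).ge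
  replace hV : ∀ a, V (π a Ψ) = π (θ a) Ψ := hV
  have hinvolutive : V * V = 1 := eq_of_eq_on_orbit hΨ fun a => by
    rw [mul_apply_eq_comp, hV, hV, hθ, one_apply_eq_self]
  have hisometry : star V * V = 1 := (ContinuousLinearMap.norm_map_iff_adjoint_comp_self V).mp <|
    hΨ.induction (Set.forall_mem_range.mpr fun a => (congrArg norm (hV a)).trans (hnorm a))
      (isClosed_eq (by fun_prop) (by fun_prop))
  have hstar : star V = V := left_inv_eq_right_inv hisometry hinvolutive
  refine ⟨V, ⟨Unitary.mem_iff.mpr ⟨hisometry, by rw [hstar, hinvolutive]⟩, ?_, fun a => ?_⟩,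
    hstar, hV⟩
  · simpa using hV 1
  · refine hstar.symm ▸ eq_of_eq_on_orbit hΨ fun b => ?_
    rw [mul_apply_eq_comp, mul_apply_eq_comp, hV, ← representation_mul_apply, hV, map_mul θ, hθ,
      representation_mul_apply]

/-- The unitary `V` fixes `S² Ψ`, because testing `S² Ψ` against the orbit of `Ψ` gives the
invariant form of `S Ψ`. -/
theorem isEvenOperator_mul_self {Ψ : H} (hΨ : Dense (Set.range fun a => π a Ψ)) {θ : B →⋆ₐ[ℂ] B}
    (hθ : ∀ a, θ (θ a) = a) (hinv : ∀ a, vectorForm π Ψ (θ a) = vectorForm π Ψ a)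
    {S : H →L[ℂ] H} (hS : IsSelfAdjoint S) (hcomm : ∀ a, Commute S (π a))
    (hSinv : ∀ a, vectorForm π (S Ψ) (θ a) = vectorForm π (S Ψ) a) :
    IsEvenOperator π Ψ θ (S * S) := by
  obtain ⟨V, hV, hVsa, hVorbit⟩ := exists_implements hΨ hθ hinv
  have hS_map : ∀ a x, S (π a x) = π a (S x) := fun a => DFunLike.congr_fun (hcomm a)
  have htest : ∀ a, ⟪π a Ψ, S (S Ψ)⟫_ℂ = vectorForm π (S Ψ) (star a) := fun a => by
    rw [inner_representation_left, ← hS_map, vectorForm_apply]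
    exact (hS.isSymmetric _ _).symm
  have hfix : V (S (S Ψ)) = S (S Ψ) := by
    refine hΨ.eq_of_inner_right ℂ (Set.forall_mem_range.mpr fun a => ?_)
    rw [← hVsa.isSymmetric.apply_clm, hVorbit, htest, htest, ← map_star θ, hSinv]
  refine ⟨V, hV, eq_of_eq_on_orbit hΨ fun a => ?_⟩
  calc (V * (S * S) * V) (π a Ψ) = V (π (θ a) (V (S (S Ψ)))) := by
        rw [hfix, ← hS_map, ← hS_map, ← hVorbit]; rfl
    _ = (V * π (θ a) * star V) (S (S Ψ)) := by rw [hVsa.star_eq]; rfl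
    _ = (S * S) (π a Ψ) := by rw [hV.2.2, hθ, ← hS_map, ← hS_map]; rfl

theorem commute_sqrt_of_mem_centralizer {T : H →L[ℂ] H} (hT : T ∈ Set.centralizer (Set.range π))
    (a : B) : Commute (CFC.sqrt T) (π a) :=
  Commute.cfcₙ_nnreal (Set.mem_centralizer_iff.mp hT _ ⟨a, rfl⟩).symm _

theorem isEvenOperator_of_describes {Ψ : H} (hΨ : Dense (Set.range fun a => π a Ψ))
    {θ : B →⋆ₐ[ℂ] B} (hθ : ∀ a, θ (θ a) = a)
    (hinv : ∀ a, vectorForm π Ψ (θ a) = vectorForm π Ψ a) {T : H →L[ℂ] H} (hT : 0 ≤ T)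
    (hcomm : T ∈ Set.centralizer (Set.range π)) {ψ : B →ₗ[ℂ] ℂ} (hψ : Describes π Ψ T ψ)
    (hψinv : ∀ a, ψ (θ a) = ψ a) : IsEvenOperator π Ψ θ T := by
  have heven := isEvenOperator_mul_self hΨ hθ hinv (CFC.sqrt_nonneg T).isSelfAdjoint
    (commute_sqrt_of_mem_centralizer hcomm) fun a => by
      rw [vectorForm_apply, vectorForm_apply, ← hψ, ← hψ, hψinv]
  rwa [CFC.sqrt_mul_sqrt_self T hT] at heven

theorem re_vectorForm_le_of_commute {S : H →L[ℂ] H} (hS : ∀ a, Commute S (π a)) (ξ : H) (a : B) :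
    (vectorForm π (S ξ) (star a * a)).re ≤ ‖S‖ ^ 2 * (vectorForm π ξ (star a * a)).re := by
  have hS_map : π a (S ξ) = S (π a ξ) := (DFunLike.congr_fun (hS a) ξ).symm
  rw [re_vectorForm_star_mul_self, re_vectorForm_star_mul_self, ← mul_pow, hS_map]
  gcongr
  exact S.le_opNorm _

theorem centreVN_subset_centralizer : centreVN π ⊆ Set.centralizer (Set.range π) :=
  Set.inter_subset_right.trans <| Set.centralizer_subset Set.subset_centralizer_centralizer

theorem IsAffiliated.map_mem_graph {S : H →ₗ.[ℂ] H}
    (hS : IsAffiliated (Set.centralizer (Set.range π)) S) {x y : H} (hxy : (x, y) ∈ S.graph)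
    (a : B) : (π a x, π a y) ∈ S.graph := by
  have hunitary : ∀ u ∈ (unitary B : Set B), (π u x, π u y) ∈ S.graph := fun u hu =>
    hS _ (Set.subset_centralizer_centralizer ⟨u, rfl⟩) (Unitary.map_mem π hu) _ _ hxy
  have ha : a ∈ Submodule.span ℂ (unitary B : Set B) :=
    CStarAlgebra.span_unitary (A := B) ▸ Submodule.mem_top
  have hle : Submodule.span ℂ (unitary B : Set B) ≤
      S.graph.comap ((orbitMap π x).prod (orbitMap π y)) := Submodule.span_le.mpr hunitary
  exact hle ha

/-- The bound on `π(a) Ψ ↦ π(a) η` extends this map to an everywhere defined operator, whose graph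
lies in the closed graph of `T^{1/2}` and therefore equals it. -/
theorem exists_isEvenOperator_of_isAffiliated {Ψ η : H}
    (hΨ : Dense (Set.range fun a => π a Ψ)) {θ : B →⋆ₐ[ℂ] B} (hθ : ∀ a, θ (θ a) = a)
    (hΨinv : ∀ a, vectorForm π Ψ (θ a) = vectorForm π Ψ a)
    (hηinv : ∀ a, vectorForm π η (θ a) = vectorForm π η a) {C : ℝ}
    (hle : ∀ a, (vectorForm π η (star a * a)).re ≤ C ^ 2 * (vectorForm π Ψ (star a * a)).re)
    {S T : H →ₗ.[ℂ] H} (hT : IsAffiliated (Set.centralizer (Set.range π)) T)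
    (hS : IsPositiveSqrt S T) (hη : (Ψ, η) ∈ S.graph) :
    ∃ T₀ : H →L[ℂ] H, T = (T₀ : H →ₗ[ℂ] H).toPMap ⊤ ∧ IsEvenOperator π Ψ θ T₀ := by
  have hbound : ∀ a, ‖orbitMap π η a‖ ≤ |C| * ‖π a Ψ‖ := fun a => by
    have h := hle a
    rw [re_vectorForm_star_mul_self, re_vectorForm_star_mul_self, ← sq_abs C, ← mul_pow] at h
    exact (sq_le_sq₀ (norm_nonneg _) (by positivity)).mp h
  obtain ⟨S₀, hS₀⟩ := exists_extension_of_orbit hΨ (orbitMap π η) hbound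
  replace hS₀ : ∀ a, S₀ (π a Ψ) = π a η := hS₀
  have hS_eq : S = (S₀ : H →ₗ[ℂ] H).toPMap ⊤ :=
    eq_toPMap_top_of_dense hS.1.1.isClosed S₀ hΨ <| Set.forall_mem_range.mpr fun a =>
      hS₀ a ▸ (hT.of_isPositiveSqrt hS).map_mem_graph hη a
  have hcomm : ∀ a, Commute S₀ (π a) := fun a => eq_of_eq_on_orbit hΨ fun b => by
    rw [mul_apply_eq_comp, mul_apply_eq_comp, ← representation_mul_apply, hS₀, hS₀,
      representation_mul_apply]
  have hη_eq : S₀ Ψ = η := by simpa using hS₀ 1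
  subst hS_eq hη_eq
  exact ⟨S₀ * S₀, hS.eq_mul_self,
    isEvenOperator_mul_self hΨ hθ hΨinv (isSelfAdjoint_of_toPMap_top hS.1.1) hcomm hηinv⟩

end Representation

/-! ### Localization in the sample space -/

section Localization

open LInfinity TopologicalSpace

variable {A : Type*} [CStarAlgebra A] {Ω : Type*} [MeasurableSpace Ω] {μ : Measure Ω}

/-- The element `a ⊗ 1_s` of `A ⊗ L^∞(Ω, μ)`. -/
noncomputable def indicatorTensor (μ : Measure Ω) (a : A) {s : Set Ω} (hs : MeasurableSet s) :
    disorderedAlgebra A μ :=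
  ⟨tensor a (((memLp_top_const (1 : ℂ)).indicator hs).toLp _), tensor_mem_disorderedAlgebra _ _⟩

theorem coeFn_indicatorTensor (a : A) {s : Set Ω} (hs : MeasurableSet s) :
    (indicatorTensor μ a hs : Lp A ∞ μ) =ᵐ[μ] s.indicator fun _ => a := by
  filter_upwards [ContinuousLinearMap.coeFn_compLp (ContinuousLinearMap.toSpanSingleton ℂ a)
    (((memLp_top_const (1 : ℂ)).indicator hs).toLp (μ := μ)),
    (((memLp_top_const (1 : ℂ)).indicator hs).coeFn_toLp (μ := μ))] with ω h_comp h_toLp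
  refine h_comp.trans ?_
  rw [h_toLp]
  by_cases hω : ω ∈ s <;> simp [hω]

theorem star_mul_indicatorTensor (a : A) {s : Set Ω} (hs : MeasurableSet s) :
    star (indicatorTensor μ a hs) * indicatorTensor μ a hs = indicatorTensor μ (star a * a) hs := by
  apply Subtype.ext
  apply Lp.ext
  filter_upwards [coeFn_mul (star (indicatorTensor μ a hs : Lp A ∞ μ)) (indicatorTensor μ a hs),
    coeFn_star (indicatorTensor μ a hs : Lp A ∞ μ), coeFn_indicatorTensor (μ := μ) a hs,
    coeFn_indicatorTensor (μ := μ) (star a * a) hs] with ω h_mul h_star h_a h_star_a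
  refine h_mul.trans ?_
  rw [h_star, h_a, h_star_a]
  by_cases hω : ω ∈ s <;> simp [hω]

theorem apply_indicatorTensor_ae_eq (g : Ω → A →L[ℂ] ℂ) (a : A) {s : Set Ω} (hs : MeasurableSet s) :
    (fun ω => g ω ((indicatorTensor μ a hs : Lp A ∞ μ) ω)) =ᵐ[μ] s.indicator fun ω => g ω a := by
  filter_upwards [coeFn_indicatorTensor (μ := μ) a hs] with ω h
  rw [h]
  by_cases hω : ω ∈ s <;> simp [hω]

/-- The field of functionals `g ω` on `A` is a decomposition `ψ(F) = ∫ g_ω(F(ω)) dμ(ω)`. The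
integrability of `ω ↦ g_ω(F(ω))` is part of the definition. -/
def IsFieldIntegral (ψ : disorderedAlgebra A μ →ₗ[ℂ] ℂ) (g : Ω → A →L[ℂ] ℂ) : Prop :=
  ∀ F : disorderedAlgebra A μ, Integrable (fun ω => g ω ((F : Lp A ∞ μ) ω)) μ ∧
    ψ F = ∫ ω, g ω ((F : Lp A ∞ μ) ω) ∂μ

namespace IsFieldIntegral

variable {ψ ψ' : disorderedAlgebra A μ →ₗ[ℂ] ℂ} {g g' : Ω → A →L[ℂ] ℂ}

theorem integrable (h : IsFieldIntegral ψ g) (a : A) : Integrable (fun ω => g ω a) μ := by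
  simpa using (h (indicatorTensor μ a MeasurableSet.univ)).1.congr
    (apply_indicatorTensor_ae_eq g a MeasurableSet.univ)

theorem apply_indicatorTensor (h : IsFieldIntegral ψ g) (a : A) {s : Set Ω}
    (hs : MeasurableSet s) : ψ (indicatorTensor μ a hs) = ∫ ω in s, g ω a ∂μ := by
  rw [(h _).2, integral_congr_ae (apply_indicatorTensor_ae_eq g a hs), integral_indicator hs]

theorem re_apply_indicatorTensor (h : IsFieldIntegral ψ g) (a : A) {s : Set Ω}
    (hs : MeasurableSet s) : (ψ (indicatorTensor μ a hs)).re = ∫ ω in s, (g ω a).re ∂μ := by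
  rw [h.apply_indicatorTensor]
  exact (integral_re (h.integrable a).restrict).symm

theorem ae_eq [SeparableSpace A] (h : IsFieldIntegral ψ g) (h' : IsFieldIntegral ψ g') :
    ∀ᵐ ω ∂μ, ∀ a, g ω a = g' ω a := by
  have hpoint : ∀ a, ∀ᵐ ω ∂μ, g ω a = g' ω a := fun a =>
    Integrable.ae_eq_of_forall_setIntegral_eq _ _ (h.integrable a) (h'.integrable a)
      fun s hs _ => by rw [← h.apply_indicatorTensor a hs, h'.apply_indicatorTensor a hs]
  filter_upwards [ae_all_iff.mpr fun n => hpoint (denseSeq A n)] with ω hω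
  exact congrFun <|
    (denseRange_denseSeq A).equalizer (g ω).continuous (g' ω).continuous (funext hω)

theorem ae_re_le [SeparableSpace A] (h : IsFieldIntegral ψ g) (h' : IsFieldIntegral ψ' g') {C : ℝ}
    (hle : ∀ F, (ψ (star F * F)).re ≤ C * (ψ' (star F * F)).re) :
    ∀ᵐ ω ∂μ, ∀ a, (g ω (star a * a)).re ≤ C * (g' ω (star a * a)).re := by
  have hpoint : ∀ a, ∀ᵐ ω ∂μ, (g ω (star a * a)).re ≤ C * (g' ω (star a * a)).re := fun a =>
    ae_le_of_forall_setIntegral_le (h.integrable _).re ((h'.integrable _).re.const_mul C)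
      fun s hs _ => by
        have hs_le := hle (indicatorTensor μ a hs)
        rw [star_mul_indicatorTensor, h.re_apply_indicatorTensor,
          h'.re_apply_indicatorTensor] at hs_le
        rw [integral_const_mul]
        exact hs_le
  filter_upwards [ae_all_iff.mpr fun n => hpoint (denseSeq A n)] with ω hω
  exact (denseRange_denseSeq A).induction (Set.forall_mem_range.mpr hω)
    (isClosed_le (by fun_prop) (by fun_prop))

end IsFieldIntegral

theorem IsDisintegration.isFieldIntegral_vectorForm {φ : disorderedAlgebra A μ →ₗ[ℂ] ℂ}
    {φfib : Ω → A →ₗ[ℂ] ℂ} (h : IsDisintegration φ φfib) {K : Ω → Type*}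
    [∀ ω, NormedAddCommGroup (K ω)] [∀ ω, InnerProductSpace ℂ (K ω)] [∀ ω, CompleteSpace (K ω)]
    {π : ∀ ω, A →⋆ₐ[ℂ] (K ω →L[ℂ] K ω)} {Ψ : ∀ ω, K ω} (hπ : ∀ ω, IsGNS (φfib ω) (π ω) (Ψ ω)) :
    IsFieldIntegral φ fun ω => vectorForm (π ω) (Ψ ω) := fun F => by
  simpa only [(hπ _).1, vectorForm_apply] using h.2 F

section PointwiseAction

variable [SeparableSpace A]

/-- The action `σ ⊗ id` on `A ⊗ L^∞(Ω, μ)` of a single endomorphism `σ` of `A`. -/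
noncomputable def pointwiseAction (μ : Measure Ω) (σ : A →⋆ₐ[ℂ] A) :
    disorderedAlgebra A μ →⋆ₐ[ℂ] disorderedAlgebra A μ :=
  fibreAction (fun _ => σ) (fun _ => stronglyMeasurable_const) fun a =>
    ⟨indicatorTensor μ (σ a) MeasurableSet.univ, SetLike.coe_mem _,
      (coeFn_indicatorTensor (σ a) MeasurableSet.univ).mono fun ω hω => by simpa using hω⟩

theorem coeFn_pointwiseAction (σ : A →⋆ₐ[ℂ] A) (F : disorderedAlgebra A μ) :
    ∀ᵐ ω ∂μ, (pointwiseAction μ σ F : Lp A ∞ μ) ω = σ ((F : Lp A ∞ μ) ω) :=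
  coeFn_fibreHom _ (fun _ => stronglyMeasurable_const) _

theorem pointwiseAction_involutive {σ : A →⋆ₐ[ℂ] A} (hσ : ∀ a, σ (σ a) = a)
    (F : disorderedAlgebra A μ) : pointwiseAction μ σ (pointwiseAction μ σ F) = F := by
  apply Subtype.ext
  apply Lp.ext
  filter_upwards [coeFn_pointwiseAction σ F, coeFn_pointwiseAction σ (pointwiseAction μ σ F)]
    with ω hF hσF
  rw [hσF, hF, hσ]

theorem IsFieldIntegral.ae_apply_eq {σ : A →⋆ₐ[ℂ] A} {ψ : disorderedAlgebra A μ →ₗ[ℂ] ℂ}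
    {g : Ω → A →L[ℂ] ℂ} (h : IsFieldIntegral ψ g) (hψ : ∀ F, ψ (pointwiseAction μ σ F) = ψ F) :
    ∀ᵐ ω ∂μ, ∀ a, g ω (σ a) = g ω a := by
  have hσ : IsFieldIntegral ψ fun ω =>
      (g ω).comp ⟨(σ : A →ₗ[ℂ] A), map_continuous σ⟩ := fun F => by
    have hcongr : (fun ω => g ω ((pointwiseAction μ σ F : Lp A ∞ μ) ω)) =ᵐ[μ]
        fun ω => g ω (σ ((F : Lp A ∞ μ) ω)) :=
      (coeFn_pointwiseAction σ F).mono fun ω hω => congrArg (g ω) hω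
    exact ⟨(h _).1.congr hcongr, by rw [← hψ, (h _).2]; exact integral_congr_ae hcongr⟩
  exact hσ.ae_eq h

theorem DisorderedSystem.grading_eq_pointwiseAction {d : ℕ} [IsProbabilityMeasure μ]
    (D : DisorderedSystem d A μ) : D.grading = pointwiseAction μ (D.σ : A →⋆ₐ[ℂ] A) := rfl

end PointwiseAction

end Localization

theorem proposition7p5_general {A : Type*} [CStarAlgebra A] [TopologicalSpace.SeparableSpace A]
    {Ω : Type*} [MeasurableSpace Ω] {μ : Measure Ω} {σ : A →⋆ₐ[ℂ] A} (hσ : ∀ a, σ (σ a) = a)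
    {φ ψ : disorderedAlgebra A μ →ₗ[ℂ] ℂ} (hφ : ∀ F, φ (pointwiseAction μ σ F) = φ F)
    (hψ : ∀ F, ψ (pointwiseAction μ σ F) = ψ F)
    {H : Type*} [NormedAddCommGroup H] [InnerProductSpace ℂ H] [CompleteSpace H]
    {π : disorderedAlgebra A μ →⋆ₐ[ℂ] (H →L[ℂ] H)} {Φ : H} (hπ : IsGNS φ π Φ)
    {T : H →L[ℂ] H} (hTpos : 0 ≤ T) (hTcomm : T ∈ Set.centralizer (Set.range π))
    (hT : Describes π Φ T ψ) :
    IsEvenOperator π Φ (pointwiseAction μ σ) T ∧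
    ∀ (K : Ω → Type*) [∀ ω, NormedAddCommGroup (K ω)] [∀ ω, InnerProductSpace ℂ (K ω)]
      [∀ ω, CompleteSpace (K ω)] (πfib : ∀ ω, A →⋆ₐ[ℂ] (K ω →L[ℂ] K ω)) (Ψ η : ∀ ω, K ω),
      (∀ᵐ ω ∂μ, Dense (Set.range fun a => πfib ω a (Ψ ω))) →
      IsFieldIntegral φ (fun ω => vectorForm (πfib ω) (Ψ ω)) →
      IsFieldIntegral ψ (fun ω => vectorForm (πfib ω) (η ω)) →
      ∀ Tfib : ∀ ω, K ω →ₗ.[ℂ] K ω,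
        (∀ᵐ ω ∂μ, IsAffiliated (Set.centralizer (Set.range (πfib ω))) (Tfib ω) ∧
          ∃ S, IsPositiveSqrt S (Tfib ω) ∧ (Ψ ω, η ω) ∈ S.graph) →
        ∀ᵐ ω ∂μ, ∃ T₀ : K ω →L[ℂ] K ω, Tfib ω = (T₀ : K ω →ₗ[ℂ] K ω).toPMap ⊤ ∧
          IsEvenOperator (πfib ω) (Ψ ω) σ T₀ := by
  have hφ_eq : ∀ F, φ F = vectorForm π Φ F := hπ.1
  have hψ_eq : ∀ F, ψ F = vectorForm π (CFC.sqrt T Φ) F := hT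
  have hdom : ∀ F, (ψ (star F * F)).re ≤ ‖CFC.sqrt T‖ ^ 2 * (φ (star F * F)).re := fun F => by
    rw [hφ_eq, hψ_eq]
    exact re_vectorForm_le_of_commute (commute_sqrt_of_mem_centralizer hTcomm) Φ F
  refine ⟨isEvenOperator_of_describes hπ.2 (pointwiseAction_involutive hσ)
    (fun F => by rw [← hφ_eq, ← hφ_eq, hφ]) hTpos hTcomm hT hψ, ?_⟩
  intro K _ _ _ πfib Ψ η hdense hΨ hη Tfib hTfib
  filter_upwards [hdense, hΨ.ae_apply_eq hφ, hη.ae_apply_eq hψ, hη.ae_re_le hΨ hdom, hTfib]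
    with ω hω hΨω hηω hle ⟨haff, S, hS, hSη⟩
  exact exists_isEvenOperator_of_isAffiliated hω hσ hΨω hηω hle haff hS hSη

theorem proposition7p5 {d : ℕ} {A : Type*} [CStarAlgebra A] [TopologicalSpace.SeparableSpace A]
    {Ω : Type*} [MeasurableSpace Ω] [StandardBorelSpace Ω] {μ : Measure Ω} [IsProbabilityMeasure μ]
    (D : DisorderedSystem d A μ) {β : ℝ} (hβ : β ≠ 0)
    -- the reference state: an even KMS state, normal on `L^∞(Ω, μ)`, with its GNS triple
    (φ : disorderedAlgebra A μ →ₗ[ℂ] ℂ) (hφ : IsState φ)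
    (hφKMS : IsKMS D.evolution β φ) (hφnormal : IsNormalOnCentre φ)
    (hφeven : ∀ F, φ (D.grading F) = φ F)
    {H : Type*} [NormedAddCommGroup H] [InnerProductSpace ℂ H] [CompleteSpace H]
    (π : disorderedAlgebra A μ →⋆ₐ[ℂ] (H →L[ℂ] H)) (Φ : H) (hπ : IsGNS φ π Φ)
    -- the even KMS state described by the bounded positive operator `T` in the centre
    (φT : disorderedAlgebra A μ →ₗ[ℂ] ℂ) (hφT : IsState φT)
    (hφTKMS : IsKMS D.evolution β φT) (hφTeven : ∀ F, φT (D.grading F) = φT F)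
    (T : H →L[ℂ] H) (hTpos : 0 ≤ T) (hTcentre : T ∈ centreVN π) (hT : Describes π Φ T φT) :
    IsEvenOperator π Φ D.grading T ∧
    ∀ (φfib : Ω → A →ₗ[ℂ] ℂ), IsDisintegration φ φfib →
      ∀ (K : Ω → Type*) [∀ ω, NormedAddCommGroup (K ω)] [∀ ω, InnerProductSpace ℂ (K ω)]
        [∀ ω, CompleteSpace (K ω)] (πfib : ∀ ω, A →⋆ₐ[ℂ] (K ω →L[ℂ] K ω)) (Ψ : ∀ ω, K ω),
        (∀ ω, IsGNS (φfib ω) (πfib ω) (Ψ ω)) →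
        ∀ (Tfib : ∀ ω, K ω →ₗ.[ℂ] K ω), FibrewiseDescribes πfib Ψ Tfib φT →
          ∀ᵐ ω ∂μ, ∃ T₀ : K ω →L[ℂ] K ω,
            Tfib ω = (T₀ : K ω →ₗ[ℂ] K ω).toPMap ⊤ ∧
            IsEvenOperator (πfib ω) (Ψ ω) D.σ T₀ := by
  rw [D.grading_eq_pointwiseAction] at hφeven hφTeven ⊢
  obtain ⟨heven, hfibres⟩ := proposition7p5_general D.σ_σ hφeven hφTeven hπ hTpos
    (centreVN_subset_centralizer hTcentre) hT
  exact ⟨heven, fun φfib hφfib K _ _ _ πfib Ψ hGNS Tfib ⟨η, hη, hφη⟩ =>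
    hfibres K πfib Ψ η (.of_forall fun ω => (hGNS ω).2) (hφfib.isFieldIntegral_vectorForm hGNS) hφη
      Tfib (hη.mono fun _ ⟨_, haff, hS⟩ => ⟨haff.mono centreVN_subset_centralizer, hS⟩)⟩
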